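/- Let $p>1$, $0<h\le 1$ with $ph>1$. There is a constant $C_{p,h}>0$, depending only on $p$ and $h$, such that the following holds. Let $(\Omega,\mathcal F,\{\mathcal F_t\}_{t\ge0},\mathbb P)$ be a filtered probability space satisfying the usual conditions. Let $T>0$, $d\in\mathbb N$, and let $\{X_t\}_{t\in[0,T]}$ be a continuous $\{\mathcal F_t\}$-adapted $\mathbb R^d$-valued process with $X_t\in L^p(\Omega;\mathbb R^d)$ for all $t\in[0,T]$ which satisfies the conditional increment control $$\mathbb E\left[\left|\mathbb E(X_t\mid\mathcal F_s)-X_s\right|^p\right]\le A_{p,h}\,|t-s|^{ph}\qquad\text{for all }0\le s<t\le T,$$ with a constant $A_{p,h}\ge0$ independent of $s$ and $t$. Let $0\le s_0<t_0\le T$ and $X^*=\sup_{u\in[s_0,t_0]}|X_u|$. Then for every $1<q\le p$, $$\|X^*\|_{L^q}\le\frac{q}{q-1}\left[C_{p,h}^{1/p}A_{p,h}^{1/p}|t_0-s_0|^h+\|X_{t_0}\|_{L^q}\right].$$ -/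

import Mathlib

open MeasureTheory ProbabilityTheory
open scoped NNReal ENNReal

/-- The usual conditions for a filtration indexed by `[0, ∞)`: right-continuity, and the initial
σ-algebra contains every subset of every `P`-null set (so that `P` is complete as well). -/
structure UsualConditions {Ω : Type*} {m : MeasurableSpace Ω} (P : Measure Ω)
    (ℱ : Filtration ℝ≥0 m) : Prop where
  rightContinuous : ℱ.IsRightContinuous
  null_measurable : ∀ N : Set Ω, P N = 0 → MeasurableSet[ℱ 0] N

/-- A process on `[0, T]` that is adapted to `ℱ` and has (almost surely) continuous paths.
Only the values `X t` with `t ≤ T` matter. -/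
structure IsContinuousAdapted {Ω : Type*} {m : MeasurableSpace Ω} {d : ℕ} (P : Measure Ω)
    (ℱ : Filtration ℝ≥0 m) (T : ℝ≥0) (X : ℝ≥0 → Ω → EuclideanSpace ℝ (Fin d)) : Prop where
  adapted : ∀ t ≤ T, Measurable[ℱ t] (X t)
  continuous : ∀ᵐ ω ∂P, ContinuousOn (fun t => X t ω) (Set.Icc 0 T)

/-- The conditional increment control with parameter `(p, h)` and constant `A` on `[0, T]`:
`X t ∈ L^p` for all `t ∈ [0, T]`, and `E |E(X t | ℱ s) - X s| ^ p ≤ A |t - s| ^ (p h)` for all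
`0 ≤ s < t ≤ T`. The expectation of the nonnegative variable is a Lebesgue integral in
`[0, ∞]`. -/
structure ConditionalIncrementControl {Ω : Type*} {m : MeasurableSpace Ω} {d : ℕ} (P : Measure Ω)
    (ℱ : Filtration ℝ≥0 m) (T : ℝ≥0) (X : ℝ≥0 → Ω → EuclideanSpace ℝ (Fin d))
    (p h A : ℝ) : Prop where
  memLp : ∀ t ≤ T, MemLp (X t) (ENNReal.ofReal p) P
  nonneg : 0 ≤ A
  bound : ∀ s t : ℝ≥0, s < t → t ≤ T →
    ∫⁻ ω, ‖(P[X t | ℱ s]) ω - X s ω‖ₑ ^ p ∂P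
      ≤ ENNReal.ofReal (A * |(t : ℝ) - (s : ℝ)| ^ (p * h))

/-- The running supremum `sup_{u ∈ [s₀, t₀]} |X u|`, with values in `[0, ∞]`. -/
noncomputable def runningSup {Ω : Type*} {d : ℕ} (X : ℝ≥0 → Ω → EuclideanSpace ℝ (Fin d))
    (s₀ t₀ : ℝ≥0) (ω : Ω) : ℝ≥0∞ :=
  ⨆ u ∈ Set.Icc s₀ t₀, ‖X u ω‖ₑ

/-! Write `a = s₀`, `b = t₀`, and let `V_k` be the `ℓ^p` norm of the conditional increments over the
`k`-th dyadic subdivision. Chaining towards the terminal time shows that at a point `u` of level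
`n`, `|E(X_b | ℱ_u) - X_u| ≤ E(V_0 + ... + V_n | ℱ_u)`: each level costs at most one increment
(`norm_condExp_sub_le_condExp_sum_condVariation`). So along the grid `|X_u|` lies below the
martingale closed by `|X_b| + V_0 + ... + V_n`, and Doob's inequality supplies the factor `q / (q -
1)`.

Level `k` has `2^k` increments, so `‖V_k‖_p ≤ A^(1/p) (b - a)^h 2^(k (1/p - h))`, which is summable
because `p h > 1`. The bound does not depend on `n`; path continuity and monotone convergence pass
to the full supremum. -/

/-! ### Doob's `L^q` inequality. -/

/-- A weak-type maximal inequality `t μ(t ≤ f) ≤ ∫_{t ≤ f} g` self-improves to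
`‖f‖_q ≤ q / (q - 1) ‖g‖_q`. -/
theorem eLpNorm_le_of_mul_meas_ge_le_setLIntegral {Ω : Type*} {m : MeasurableSpace Ω}
    {μ : Measure Ω} [SFinite μ] {q : ℝ} (hq : 1 < q) {f : Ω → ℝ} {g : Ω → ℝ≥0∞}
    (hf : Measurable f) (hf0 : 0 ≤ f) (hfq : MemLp f (ENNReal.ofReal q) μ) (hg : AEMeasurable g μ)
    (hfg : ∀ t : ℝ, 0 < t →
      ENNReal.ofReal t * μ {ω | t ≤ f ω} ≤ ∫⁻ ω in {ω | t ≤ f ω}, g ω ∂μ) :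
    eLpNorm f (ENNReal.ofReal q) μ
      ≤ ENNReal.ofReal (q / (q - 1)) * eLpNorm g (ENNReal.ofReal q) μ := by
  have hq0 : 0 < q := by linarith
  have hq1 : 0 < q - 1 := by linarith
  have hqne : ENNReal.ofReal q ≠ 0 := by simpa using hq0
  have hconj : (q / (q - 1)).HolderConjugate q := (Real.HolderConjugate.conjExponent hq).symm
  have heLp : ∀ {ε : Type} [TopologicalSpace ε] [ContinuousENorm ε] (u : Ω → ε),
      eLpNorm u (ENNReal.ofReal q) μ = (∫⁻ ω, ‖u ω‖ₑ ^ q ∂μ) ^ (1 / q) := by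
    intro ε _ _ u
    rw [eLpNorm_eq_lintegral_rpow_enorm_toReal hqne ENNReal.ofReal_ne_top,
      ENNReal.toReal_ofReal hq0.le]
  have hpow : ∀ (r : ℝ), 0 < r → ∀ ω, ENNReal.ofReal (f ω ^ r) = ‖f ω‖ₑ ^ r := fun r hr ω => by
    rw [Real.enorm_of_nonneg (hf0 ω), ENNReal.ofReal_rpow_of_nonneg (hf0 ω) hr.le]
  set I := ∫⁻ ω, ‖f ω‖ₑ ^ q ∂μ with hI
  set J := ∫⁻ ω, g ω ^ q ∂μ with hJ
  have hItop : I ≠ ∞ := by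
    have := hfq.2
    rw [heLp] at this
    intro h
    rw [← hI, h, ENNReal.top_rpow_of_pos (by positivity)] at this
    exact this.ne rfl
  have hmeas : ∀ t : ℝ, MeasurableSet {ω | t ≤ f ω} := fun t => measurableSet_le measurable_const hf
  -- Layer cake on both sides of the weak-type bound, then Hölder. Finiteness of `I` later allows
  -- division by its power.
  have key : I ≤ ENNReal.ofReal (q / (q - 1)) * (I ^ (1 / (q / (q - 1))) * J ^ (1 / q)) := by
    have e1 : I = ENNReal.ofReal q *
        ∫⁻ t in Set.Ioi 0, μ {a | t ≤ f a} * ENNReal.ofReal (t ^ (q - 1)) := by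
      rw [← lintegral_rpow_eq_lintegral_meas_le_mul μ (.of_forall hf0) hf.aemeasurable hq0]
      exact lintegral_congr fun ω => (hpow q hq0 ω).symm
    -- Layer cake for `f ^ (q - 1)` under the measure with density `g`.
    have e2 : ∫⁻ ω, (g * fun ω => ‖f ω‖ₑ ^ (q - 1)) ω ∂μ = ENNReal.ofReal (q - 1) *
        ∫⁻ t in Set.Ioi 0, (∫⁻ ω in {ω | t ≤ f ω}, g ω ∂μ) * ENNReal.ofReal (t ^ (q - 1 - 1)) := by
      rw [← lintegral_withDensity_eq_lintegral_mul₀ hg (by fun_prop)]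
      simp_rw [← hpow (q - 1) hq1]
      rw [lintegral_rpow_eq_lintegral_meas_le_mul _ (.of_forall hf0) hf.aemeasurable hq1]
      simp_rw [withDensity_apply _ (hmeas _)]
    have e3 : ∫⁻ t in Set.Ioi 0, μ {a | t ≤ f a} * ENNReal.ofReal (t ^ (q - 1)) ≤
        ∫⁻ t in Set.Ioi 0, (∫⁻ ω in {ω | t ≤ f ω}, g ω ∂μ) * ENNReal.ofReal (t ^ (q - 1 - 1)) := by
      refine setLIntegral_mono_ae' measurableSet_Ioi (.of_forall fun t (ht : 0 < t) => ?_)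
      calc μ {a | t ≤ f a} * ENNReal.ofReal (t ^ (q - 1))
          = ENNReal.ofReal t * μ {a | t ≤ f a} * ENNReal.ofReal (t ^ (q - 1 - 1)) := by
            rw [Real.rpow_sub_one ht.ne' (q - 1), mul_right_comm, ← ENNReal.ofReal_mul ht.le,
              mul_div_cancel₀ _ ht.ne', mul_comm]
        _ ≤ _ := by gcongr; exact hfg t ht
    have e4 : ∫⁻ ω, (g * fun ω => ‖f ω‖ₑ ^ (q - 1)) ω ∂μ ≤ I ^ (1 / (q / (q - 1))) * J ^ (1 / q) := by
      rw [mul_comm g]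
      refine (ENNReal.lintegral_mul_le_Lp_mul_Lq μ hconj (by fun_prop) hg).trans_eq ?_
      simp_rw [← ENNReal.rpow_mul, mul_div_cancel₀ q hq1.ne']
      rfl
    calc I = ENNReal.ofReal (q / (q - 1)) * (ENNReal.ofReal (q - 1) *
        ∫⁻ t in Set.Ioi 0, μ {a | t ≤ f a} * ENNReal.ofReal (t ^ (q - 1))) := by
          rw [← mul_assoc, ← ENNReal.ofReal_mul (by positivity), div_mul_cancel₀ q hq1.ne', e1]
      _ ≤ _ := by
        refine mul_le_mul' le_rfl (le_trans ?_ e4)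
        rw [e2]
        gcongr
  rw [heLp, heLp]
  simp only [enorm_eq_self]
  rw [← hI, ← hJ]
  rcases eq_or_ne I 0 with h0 | h0
  · rw [h0, ENNReal.zero_rpow_of_pos (by positivity)]; exact zero_le
  have hsplit : I = I ^ (1 / (q / (q - 1))) * I ^ (1 / q) := by
    rw [← ENNReal.rpow_add _ _ h0 hItop]
    have : 1 / (q / (q - 1)) + 1 / q = 1 := by field_simp; ring
    rw [this, ENNReal.rpow_one]
  rw [mul_left_comm] at key
  nth_rewrite 1 [hsplit] at key
  refine (ENNReal.mul_le_mul_iff_right ?_ ?_).1 key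
  · simp [h0, hItop]
  · exact ENNReal.rpow_ne_top_of_nonneg (by positivity) hItop

/-- Doob's `L^q` inequality for a process dominated by the martingale closed by `g`. -/
theorem eLpNorm_sup'_le_of_le_condExp {Ω : Type*} {m : MeasurableSpace Ω}
    {μ : Measure Ω} [IsFiniteMeasure μ] (𝒢 : Filtration ℕ m) {q : ℝ} (hq : 1 < q)
    {E : Type*} [NormedAddCommGroup E] {x : ℕ → Ω → E} {g : Ω → ℝ} {n : ℕ}
    (hg : MemLp g (ENNReal.ofReal q) μ)
    (hx : ∀ k ≤ n, ∀ᵐ ω ∂μ, ‖x k ω‖ ≤ (μ[g | 𝒢 k]) ω) :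
    eLpNorm (fun ω => (Finset.range (n + 1)).sup' Finset.nonempty_range_add_one fun k => ‖x k ω‖)
        (ENNReal.ofReal q) μ
      ≤ ENNReal.ofReal (q / (q - 1)) * eLpNorm g (ENNReal.ofReal q) μ := by
  have hq1 : 1 ≤ ENNReal.ofReal q := by simpa using ENNReal.ofReal_le_ofReal hq.le
  -- `g` may change sign, while the maximal inequality needs a nonnegative submartingale.
  set f : ℕ → Ω → ℝ := (fun k => μ[g | 𝒢 k])⁺ with hfdef
  have hf : ∀ k ω, f k ω = max ((μ[g | 𝒢 k]) ω) 0 := fun k ω => rfl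
  have hsub : Submartingale f 𝒢 μ := (martingale_condExp g 𝒢 μ).submartingale.pos
  have hf0 : 0 ≤ f := fun k ω => by rw [hf]; exact le_max_right _ _
  have hfL : ∀ k, MemLp (f k) (ENNReal.ofReal q) μ := fun k => (hg.condExp hq1).pos_part
  set F : Ω → ℝ := fun ω => (Finset.range (n + 1)).sup' Finset.nonempty_range_add_one
    fun k => f k ω with hF
  have hFm : Measurable F := Finset.measurable_range_sup'' fun k _ =>
    (hsub.stronglyMeasurable k).measurable.mono (𝒢.le k) le_rfl
  have hF0 : 0 ≤ F := fun ω =>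
    (hf0 0 ω).trans (Finset.le_sup' (fun k => f k ω) (by simp : 0 ∈ Finset.range (n + 1)))
  have hFL : MemLp F (ENNReal.ofReal q) μ := by
    refine MemLp.mono' (memLp_finsetSum (Finset.range (n + 1)) fun k _ => hfL k)
      hFm.aestronglyMeasurable (.of_forall fun ω => ?_)
    rw [Real.norm_of_nonneg (hF0 ω)]
    refine Finset.sup'_le _ _ fun k hk => ?_
    exact Finset.single_le_sum (f := fun k => f k ω) (fun i _ => hf0 i ω) hk
  calc _ ≤ eLpNorm F (ENNReal.ofReal q) μ := by
        refine eLpNorm_mono_ae ?_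
        have : ∀ᵐ ω ∂μ, ∀ k ≤ n, ‖x k ω‖ ≤ (μ[g | 𝒢 k]) ω :=
          ae_all_iff.2 fun k => by
            by_cases hk : k ≤ n
            · filter_upwards [hx k hk] with ω hω _ using hω
            · exact .of_forall fun ω h => absurd h hk
        filter_upwards [this] with ω hω
        rw [Real.norm_of_nonneg (hF0 ω), Real.norm_of_nonneg ((norm_nonneg (x 0 ω)).trans
          (Finset.le_sup' (fun k => ‖x k ω‖) (by simp : 0 ∈ Finset.range (n + 1))))]
        refine Finset.sup'_mono_fun fun k hk => ?_
        rw [hf]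
        exact (hω k (by simpa [Nat.lt_succ_iff] using hk)).trans (le_max_left _ _)
    _ ≤ ENNReal.ofReal (q / (q - 1)) *
          eLpNorm (fun ω => ENNReal.ofReal (f n ω)) (ENNReal.ofReal q) μ := by
        refine eLpNorm_le_of_mul_meas_ge_le_setLIntegral hq hFm hF0 hFL
          (hfL n).1.aemeasurable.ennreal_ofReal fun t ht => ?_
        have := maximal_ineq hsub hf0 (ε := ⟨t, ht.le⟩) n
        rw [ofReal_integral_eq_lintegral_ofReal (hsub.integrable n).integrableOn
          (.of_forall (hf0 n))] at this
        refine le_trans (le_of_eq ?_) this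
        congr 1
        rw [ENNReal.ofReal, Real.toNNReal_of_nonneg ht.le]
        rfl
    _ = ENNReal.ofReal (q / (q - 1)) * eLpNorm (f n) (ENNReal.ofReal q) μ := by
        congr 1
        refine eLpNorm_congr_enorm_ae (.of_forall fun ω => ?_)
        rw [Real.enorm_of_nonneg (hf0 n ω), enorm_eq_self]
    _ ≤ _ := by
        gcongr
        refine le_trans (eLpNorm_mono fun ω => ?_) (eLpNorm_condExp_le_eLpNorm (m := 𝒢 n) g hq1)
        rw [Real.norm_of_nonneg (hf0 n ω), hf]
        exact max_le (le_abs_self _) (norm_nonneg _)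

/-! ### Dyadic subdivisions. -/

/-- The `j`-th point of the `n`-th dyadic subdivision of `[a, b]`; it equals `b` for `j ≥ 2 ^ n`. -/
noncomputable def dyadicPoint (a b : ℝ≥0) (n j : ℕ) : ℝ≥0 :=
  a + min ((j : ℝ≥0) / 2 ^ n) 1 * (b - a)

namespace dyadicPoint

variable {a b : ℝ≥0}

theorem monotone (a b : ℝ≥0) (n : ℕ) : Monotone (dyadicPoint a b n) := fun i j hij => by
  unfold dyadicPoint; gcongr

theorem left_le (a b : ℝ≥0) (n j : ℕ) : a ≤ dyadicPoint a b n j := le_self_add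

theorem le_right (hab : a ≤ b) (n j : ℕ) : dyadicPoint a b n j ≤ b := by
  calc dyadicPoint a b n j ≤ a + 1 * (b - a) := by
        unfold dyadicPoint; gcongr; exact min_le_right _ 1
    _ = b := by rw [one_mul, add_tsub_cancel_of_le hab]

theorem two_pow (hab : a ≤ b) (n : ℕ) : dyadicPoint a b n (2 ^ n) = b := by
  have : ((2 ^ n : ℕ) : ℝ≥0) / 2 ^ n = 1 := by push_cast; exact div_self (by positivity)
  rw [dyadicPoint, this, min_self, one_mul, add_tsub_cancel_of_le hab]

theorem succ_two_mul (a b : ℝ≥0) (n j : ℕ) :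
    dyadicPoint a b (n + 1) (2 * j) = dyadicPoint a b n j := by
  have : ((2 * j : ℕ) : ℝ≥0) / 2 ^ (n + 1) = j / 2 ^ n := by
    push_cast; rw [pow_succ, mul_comm, mul_div_mul_right _ _ (by norm_num)]
  rw [dyadicPoint, this, dyadicPoint]

theorem coe_eq (hab : a ≤ b) {n j : ℕ} (hj : j ≤ 2 ^ n) :
    (dyadicPoint a b n j : ℝ) = a + j / 2 ^ n * (b - a) := by
  have : (j : ℝ≥0) / 2 ^ n ≤ 1 := by
    rw [div_le_one (by positivity)]; exact_mod_cast hj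
  rw [dyadicPoint, min_eq_left this]
  push_cast [NNReal.coe_sub hab]
  rfl

theorem coe_succ_sub (hab : a ≤ b) {n j : ℕ} (hj : j < 2 ^ n) :
    (dyadicPoint a b n (j + 1) : ℝ) - dyadicPoint a b n j = (b - a) / 2 ^ n := by
  rw [coe_eq hab hj, coe_eq hab hj.le]; push_cast; ring

theorem lt_succ (hab : a < b) {n j : ℕ} (hj : j < 2 ^ n) :
    dyadicPoint a b n j < dyadicPoint a b n (j + 1) := by
  have h := coe_succ_sub hab.le hj
  have : (0 : ℝ) < (b - a) / 2 ^ n := div_pos (sub_pos.2 (by exact_mod_cast hab)) (by positivity)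
  rw [← NNReal.coe_lt_coe]
  linarith

end dyadicPoint

/-! ### Chaining of conditional increments. -/

section Chaining

variable {Ω : Type*} {m : MeasurableSpace Ω} {P : Measure Ω} {ℱ : Filtration ℝ≥0 m}
  {E : Type*} [NormedAddCommGroup E] [NormedSpace ℝ E]
  {X : ℝ≥0 → Ω → E} {a b : ℝ≥0} {p : ℝ}

/-- The conditional increment `E(X_v | ℱ_u) - X_u` along the `j`-th interval `[u, v]` of the `n`-th
dyadic subdivision of `[a, b]`. -/
noncomputable def condIncrement (P : Measure Ω) (ℱ : Filtration ℝ≥0 m) (X : ℝ≥0 → Ω → E)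
    (a b : ℝ≥0) (n j : ℕ) : Ω → E :=
  P[X (dyadicPoint a b n (j + 1)) | ℱ (dyadicPoint a b n j)] - X (dyadicPoint a b n j)

/-- The `ℓ^p` norm of the conditional increments along the `n`-th dyadic subdivision. -/
noncomputable def condVariation (P : Measure Ω) (ℱ : Filtration ℝ≥0 m) (X : ℝ≥0 → Ω → E)
    (a b : ℝ≥0) (p : ℝ) (n : ℕ) (ω : Ω) : ℝ :=
  (∑ j ∈ Finset.range (2 ^ n), ‖condIncrement P ℱ X a b n j ω‖ ^ p) ^ (1 / p)

theorem condVariation_nonneg (n : ℕ) (ω : Ω) : 0 ≤ condVariation P ℱ X a b p n ω :=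
  Real.rpow_nonneg (Finset.sum_nonneg fun _ _ => Real.rpow_nonneg (norm_nonneg _) _) _

/-- A single variable dominates all increments of a level, so the chaining bound is uniform in `j`.
-/
theorem norm_condIncrement_le_condVariation (hp : 0 < p) {n j : ℕ} (hj : j < 2 ^ n) (ω : Ω) :
    ‖condIncrement P ℱ X a b n j ω‖ ≤ condVariation P ℱ X a b p n ω := by
  have h := Finset.single_le_sum (f := fun j => ‖condIncrement P ℱ X a b n j ω‖ ^ p)
    (fun i _ => Real.rpow_nonneg (norm_nonneg _) p) (Finset.mem_range.2 hj)
  calc ‖condIncrement P ℱ X a b n j ω‖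
      = (‖condIncrement P ℱ X a b n j ω‖ ^ p) ^ (1 / p) := by
        rw [← Real.rpow_mul (norm_nonneg _), mul_one_div_cancel hp.ne', Real.rpow_one]
    _ ≤ _ := Real.rpow_le_rpow (Real.rpow_nonneg (norm_nonneg _) _) h (by positivity)

theorem stronglyMeasurable_condIncrement
    (hX : ∀ t ≤ b, StronglyMeasurable[ℱ t] (X t)) (hab : a ≤ b) (n j : ℕ) :
    StronglyMeasurable[ℱ (dyadicPoint a b n j)] (condIncrement P ℱ X a b n j) :=
  stronglyMeasurable_condExp.sub (hX _ (dyadicPoint.le_right hab n j))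

theorem measurable_condVariation
    (hX : ∀ t ≤ b, StronglyMeasurable[ℱ t] (X t)) (hab : a ≤ b) (n : ℕ) :
    Measurable (condVariation P ℱ X a b p n) := by
  refine Measurable.pow_const (Finset.measurable_fun_sum _ fun j _ => Measurable.pow_const ?_ _) _
  exact ((stronglyMeasurable_condIncrement hX hab n j).mono (ℱ.le _)).norm.measurable

theorem eLpNorm_condVariation_le (hp : 0 < p) (hab : a < b) {B : ℝ≥0∞} {n : ℕ}
    (hX : ∀ t ≤ b, StronglyMeasurable[ℱ t] (X t))
    (hB : ∀ j < 2 ^ n, ∫⁻ ω, ‖condIncrement P ℱ X a b n j ω‖ₑ ^ p ∂P ≤ B) :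
    eLpNorm (condVariation P ℱ X a b p n) (ENNReal.ofReal p) P ≤ (2 ^ n * B) ^ (1 / p) := by
  rw [eLpNorm_eq_lintegral_rpow_enorm_toReal (by simpa using hp) ENNReal.ofReal_ne_top,
    ENNReal.toReal_ofReal hp.le]
  gcongr
  calc ∫⁻ ω, ‖condVariation P ℱ X a b p n ω‖ₑ ^ p ∂P
      = ∫⁻ ω, ∑ j ∈ Finset.range (2 ^ n), ‖condIncrement P ℱ X a b n j ω‖ₑ ^ p ∂P := by
        refine lintegral_congr fun ω => ?_
        have h0 : ∀ j ∈ Finset.range (2 ^ n), 0 ≤ ‖condIncrement P ℱ X a b n j ω‖ ^ p :=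
          fun _ _ => Real.rpow_nonneg (norm_nonneg _) _
        rw [Real.enorm_of_nonneg (condVariation_nonneg n ω),
          ENNReal.ofReal_rpow_of_nonneg (condVariation_nonneg n ω) hp.le, condVariation,
          ← Real.rpow_mul (Finset.sum_nonneg h0), one_div_mul_cancel hp.ne', Real.rpow_one,
          ENNReal.ofReal_sum_of_nonneg h0]
        refine Finset.sum_congr rfl fun j _ => ?_
        rw [← ENNReal.ofReal_rpow_of_nonneg (norm_nonneg _) hp.le, ofReal_norm]
    _ = ∑ j ∈ Finset.range (2 ^ n), ∫⁻ ω, ‖condIncrement P ℱ X a b n j ω‖ₑ ^ p ∂P :=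
        lintegral_finsetSum' _ fun j _ =>
          (((stronglyMeasurable_condIncrement hX hab.le n j).mono
            (ℱ.le _)).aestronglyMeasurable.enorm).pow_const p
    _ ≤ ∑ j ∈ Finset.range (2 ^ n), B :=
        Finset.sum_le_sum fun j hj => hB j (Finset.mem_range.1 hj)
    _ = 2 ^ n * B := by simp

variable [CompleteSpace E]

/-- Chaining along dyadic subdivisions: the conditional increment up to the terminal time is
dominated by the conditional expectation of the sum of the variations of all levels. -/
theorem norm_condExp_sub_le_condExp_sum_condVariation [IsFiniteMeasure P] (hp : 0 < p)
    (hab : a < b) (hX : ∀ t ≤ b, StronglyMeasurable[ℱ t] (X t))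
    (hXi : ∀ t ≤ b, Integrable (X t) P)
    (hV : ∀ n, Integrable (condVariation P ℱ X a b p n) P) (n : ℕ) :
    ∀ j ≤ 2 ^ n, ∀ᵐ ω ∂P,
      ‖(P[X b | ℱ (dyadicPoint a b n j)]) ω - X (dyadicPoint a b n j) ω‖ ≤
        (P[∑ k ∈ Finset.range (n + 1), condVariation P ℱ X a b p k |
          ℱ (dyadicPoint a b n j)]) ω := by
  have hSi : ∀ n, Integrable (∑ k ∈ Finset.range n, condVariation P ℱ X a b p k) P :=
    fun n => integrable_finsetSum' _ fun k _ => hV k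
  have hS0 : ∀ n ω, 0 ≤ (∑ k ∈ Finset.range n, condVariation P ℱ X a b p k) ω := fun n ω => by
    rw [Finset.sum_apply]
    exact Finset.sum_nonneg fun k _ => condVariation_nonneg k ω
  have hinc : ∀ n j, j < 2 ^ n → ∀ᵐ ω ∂P, ‖condIncrement P ℱ X a b n j ω‖ ≤
      (P[condVariation P ℱ X a b p n | ℱ (dyadicPoint a b n j)]) ω := fun n j hj => by
    have hm := stronglyMeasurable_condIncrement (P := P) hX hab.le n j
    have hi : Integrable (fun ω => ‖condIncrement P ℱ X a b n j ω‖) P :=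
      (integrable_condExp.sub (hXi _ (dyadicPoint.le_right hab.le n j))).norm
    have h := condExp_mono (m := ℱ (dyadicPoint a b n j)) hi (hV n)
      (.of_forall fun ω => norm_condIncrement_le_condVariation hp hj ω)
    -- The increment is measurable at the left endpoint, so conditioning there leaves its norm
    -- unchanged.
    rwa [condExp_of_stronglyMeasurable (ℱ.le _) hm.norm hi] at h
  have hterm : ∀ n, ∀ᵐ ω ∂P, ‖(P[X b | ℱ b]) ω - X b ω‖ ≤
      (P[∑ k ∈ Finset.range n, condVariation P ℱ X a b p k | ℱ b]) ω := fun n => by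
    rw [condExp_of_stronglyMeasurable (ℱ.le _) (hX b le_rfl) (hXi b le_rfl)]
    filter_upwards [condExp_nonneg (m := ℱ b) (.of_forall (hS0 n))] with ω hω
    simpa using hω
  induction n with
  | zero =>
    intro j hj
    have hj' : j = 0 ∨ j = 2 ^ 0 := by rw [pow_zero] at *; omega
    rcases hj' with rfl | rfl
    · filter_upwards [hinc 0 0 (by simp)] with ω hω
      have h1 : dyadicPoint a b 0 (0 + 1) = b := by simpa using dyadicPoint.two_pow hab.le 0
      rw [condIncrement, h1] at hω
      simpa using hω
    · rw [dyadicPoint.two_pow hab.le]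
      exact hterm _
  | succ n ih =>
    intro j hj
    -- Even indices are points of level `n`; an odd one is new, and its right neighbour has level
    -- `n`.
    obtain ⟨i, rfl | rfl⟩ := Nat.even_or_odd' j
    · rw [dyadicPoint.succ_two_mul]
      have hi : i ≤ 2 ^ n := by rw [pow_succ] at hj; omega
      have hmono := condExp_mono (m := ℱ (dyadicPoint a b n i)) (hSi (n + 1)) (hSi (n + 1 + 1))
        (.of_forall fun ω => by
          rw [Finset.sum_range_succ _ (n + 1)]
          exact le_add_of_nonneg_right (condVariation_nonneg (n + 1) ω))
      filter_upwards [ih i hi, hmono] with ω h1 h2 using h1.trans h2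
    · have hj' : 2 * i + 1 < 2 ^ (n + 1) := by rw [pow_succ] at *; omega
      have hi : i + 1 ≤ 2 ^ n := by rw [pow_succ] at hj'; omega
      have hv : dyadicPoint a b (n + 1) (2 * i + 1 + 1) = dyadicPoint a b n (i + 1) :=
        dyadicPoint.succ_two_mul a b n (i + 1)
      have huv := dyadicPoint.lt_succ hab hj'
      have hinc' := hinc (n + 1) _ hj'
      rw [condIncrement] at hinc'
      rw [hv] at huv hinc'
      set u := dyadicPoint a b (n + 1) (2 * i + 1)
      set v := dyadicPoint a b n (i + 1)
      have hvb : v ≤ b := dyadicPoint.le_right hab.le _ _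
      have htower := condExp_condExp_of_le (μ := P) (f := X b) (ℱ.mono huv.le) (ℱ.le v)
      have htowerS := condExp_condExp_of_le (μ := P)
        (f := ∑ k ∈ Finset.range (n + 1), condVariation P ℱ X a b p k) (ℱ.mono huv.le) (ℱ.le v)
      have hsub := condExp_sub (μ := P) (integrable_condExp (f := X b) (m := ℱ v)) (hXi v hvb) (ℱ u)
      have hmono := condExp_mono (m := ℱ u)
        ((integrable_condExp (f := X b) (m := ℱ v)).sub (hXi v hvb)).norm integrable_condExp
        (ih (i + 1) hi)
      have hnorm := norm_condExp_le (μ := P) (m := ℱ u) (P[X b | ℱ v] - X v)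
      have hadd := condExp_add (μ := P) (hSi (n + 1)) (hV (n + 1)) (ℱ u)
      rw [Finset.sum_range_succ _ (n + 1)]
      filter_upwards [htower, htowerS, hsub, hmono, hnorm, hadd, hinc'] with
        ω h1 h2 h3 h4 h5 h6 h7
      rw [h6, Pi.add_apply, ← h2, ← h1]
      rw [Pi.sub_apply] at h3 h7
      -- By the tower property, insert `E(X_v | ℱ_u)`: the first bracket is the conditioned error at
      -- `v`, bounded by induction, and the second is one increment of level `n + 1`.
      calc _ = ‖((P[P[X b | ℱ v] | ℱ u]) ω - (P[X v | ℱ u]) ω) +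
            ((P[X v | ℱ u]) ω - X u ω)‖ := by congr 1; abel
        _ ≤ _ := (norm_add_le _ _).trans (add_le_add ?_ h7)
      rw [← h3]
      exact h5.trans h4

/-- The process along a dyadic subdivision is dominated by a closed martingale. -/
theorem norm_le_condExp_norm_add_sum_condVariation [IsFiniteMeasure P] (hp : 0 < p)
    (hab : a < b) (hX : ∀ t ≤ b, StronglyMeasurable[ℱ t] (X t))
    (hXi : ∀ t ≤ b, Integrable (X t) P)
    (hV : ∀ n, Integrable (condVariation P ℱ X a b p n) P) (n : ℕ) {j : ℕ} (hj : j ≤ 2 ^ n) :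
    ∀ᵐ ω ∂P, ‖X (dyadicPoint a b n j) ω‖ ≤
        (P[(fun ω => ‖X b ω‖) + ∑ k ∈ Finset.range (n + 1), condVariation P ℱ X a b p k |
          ℱ (dyadicPoint a b n j)]) ω := by
  filter_upwards [norm_condExp_sub_le_condExp_sum_condVariation hp hab hX hXi hV n j hj,
    norm_condExp_le (μ := P) (m := ℱ (dyadicPoint a b n j)) (X b),
    condExp_add (hXi b le_rfl).norm (integrable_finsetSum' (Finset.range (n + 1)) fun k _ => hV k)
      (ℱ (dyadicPoint a b n j))] with ω h1 h2 h3
  rw [h3, Pi.add_apply]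
  calc _ ≤ ‖(P[X b | ℱ (dyadicPoint a b n j)]) ω‖ +
        ‖(P[X b | ℱ (dyadicPoint a b n j)]) ω - X (dyadicPoint a b n j) ω‖ :=
        norm_le_norm_add_norm_sub _ _
    _ ≤ _ := add_le_add h2 h1

end Chaining

/-! ### From dyadic maxima to the full supremum. -/

open Filter Topology in
/-- Every point of `[a, b]` is a limit of points of the dyadic subdivisions. -/
theorem dyadicPoint.exists_tendsto {a b u : ℝ≥0} (hab : a < b) (hu : u ∈ Set.Icc a b) :
    ∃ j : ℕ → ℕ, (∀ n, j n ≤ 2 ^ n) ∧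
      Tendsto (fun n => dyadicPoint a b n (j n)) atTop (𝓝 u) := by
  have hba : b - a ≠ 0 := (tsub_pos_of_lt hab).ne'
  set x : ℝ≥0 := (u - a) / (b - a) with hx
  have hx1 : x ≤ 1 := div_le_one_of_le₀ (tsub_le_tsub_right hu.2 a) zero_le
  -- The last grid point not exceeding `u`.
  refine ⟨fun n => ⌊(x : ℝ) * 2 ^ n⌋₊, fun n => Nat.floor_le_of_le ?_, ?_⟩
  · push_cast
    exact mul_le_of_le_one_left (by positivity) (by exact_mod_cast hx1)
  · have h1 : Tendsto (fun n : ℕ => ((⌊(x : ℝ) * 2 ^ n⌋₊ : ℝ≥0) / 2 ^ n)) atTop (𝓝 x) := by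
      rw [← NNReal.tendsto_coe]
      push_cast
      exact (tendsto_nat_floor_mul_div_atTop x.coe_nonneg).comp
        (tendsto_pow_atTop_atTop_of_one_lt (one_lt_two (α := ℝ)))
    have h2 := ((h1.min (tendsto_const_nhds (x := (1 : ℝ≥0)))).mul_const (b - a)).const_add a
    rwa [min_eq_left hx1, hx, div_mul_cancel₀ _ hba, add_tsub_cancel_of_le hu.1] at h2

section DyadicSup

variable {E : Type*} [NormedAddCommGroup E]

/-- The maximum of `‖f‖` over the `n`-th dyadic subdivision of `[a, b]`. -/
noncomputable def dyadicSup (a b : ℝ≥0) (f : ℝ≥0 → E) (n : ℕ) : ℝ :=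
  (Finset.range (2 ^ n + 1)).sup' Finset.nonempty_range_add_one fun j => ‖f (dyadicPoint a b n j)‖

theorem norm_le_dyadicSup (a b : ℝ≥0) (f : ℝ≥0 → E) {n j : ℕ} (hj : j ≤ 2 ^ n) :
    ‖f (dyadicPoint a b n j)‖ ≤ dyadicSup a b f n :=
  Finset.le_sup' (fun j => ‖f (dyadicPoint a b n j)‖) (by simpa [Nat.lt_succ_iff] using hj)

theorem dyadicSup_nonneg (a b : ℝ≥0) (f : ℝ≥0 → E) (n : ℕ) : 0 ≤ dyadicSup a b f n :=
  (norm_nonneg _).trans (norm_le_dyadicSup a b f (Nat.zero_le _))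

theorem monotone_dyadicSup (a b : ℝ≥0) (f : ℝ≥0 → E) : Monotone (dyadicSup a b f) := by
  refine monotone_nat_of_le_succ fun n => Finset.sup'_le _ _ fun j hj => ?_
  have hj' : j ≤ 2 ^ n := by simpa [Nat.lt_succ_iff] using hj
  rw [← dyadicPoint.succ_two_mul]
  exact norm_le_dyadicSup a b f (by rw [pow_succ]; omega)

/-- Density of the dyadic points and continuity of the path. -/
theorem iSup_Icc_enorm_eq_iSup_dyadicSup {a b : ℝ≥0} (hab : a < b) {f : ℝ≥0 → E}
    (hf : ContinuousOn f (Set.Icc a b)) :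
    ⨆ u ∈ Set.Icc a b, ‖f u‖ₑ = ⨆ n, ENNReal.ofReal (dyadicSup a b f n) := by
  have hmem : ∀ n j, dyadicPoint a b n j ∈ Set.Icc a b := fun n j =>
    ⟨dyadicPoint.left_le a b n j, dyadicPoint.le_right hab.le n j⟩
  apply le_antisymm
  · refine iSup₂_le fun u hu => ?_
    obtain ⟨j, hj, hlim⟩ := dyadicPoint.exists_tendsto hab hu
    have hlim' := (hf u hu).tendsto.comp
      (tendsto_nhdsWithin_iff.2 ⟨hlim, .of_forall fun n => hmem n (j n)⟩)
    refine le_of_tendsto hlim'.enorm (.of_forall fun n => ?_)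
    refine le_trans ?_ (le_iSup _ n)
    rw [← ofReal_norm]
    exact ENNReal.ofReal_le_ofReal (norm_le_dyadicSup a b f (hj n))
  · refine iSup_le fun n => ?_
    obtain ⟨j, -, hj⟩ := Finset.exists_mem_eq_sup' (s := Finset.range (2 ^ n + 1))
      Finset.nonempty_range_add_one fun j => ‖f (dyadicPoint a b n j)‖
    rw [dyadicSup, hj, ofReal_norm]
    exact le_iSup₂ (f := fun u (_ : u ∈ Set.Icc a b) => ‖f u‖ₑ) _ (hmem n j)

end DyadicSup

/-- Monotone convergence for `L^q` seminorms of `[0, ∞]`-valued functions. -/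
theorem eLpNorm_iSup_le_of_monotone {Ω : Type*} {m : MeasurableSpace Ω} {μ : Measure Ω} {q : ℝ}
    (hq : 0 < q) {f : ℕ → Ω → ℝ≥0∞} (hf : ∀ n, Measurable (f n)) (hmono : Monotone f) {K : ℝ≥0∞}
    (hK : ∀ n, eLpNorm (f n) (ENNReal.ofReal q) μ ≤ K) :
    eLpNorm (fun ω => ⨆ n, f n ω) (ENNReal.ofReal q) μ ≤ K := by
  have heLp : ∀ u : Ω → ℝ≥0∞,
      eLpNorm u (ENNReal.ofReal q) μ = (∫⁻ ω, u ω ^ q ∂μ) ^ (1 / q) := fun u => by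
    rw [eLpNorm_eq_lintegral_rpow_enorm_toReal (by simpa using hq) ENNReal.ofReal_ne_top,
      ENNReal.toReal_ofReal hq.le]
    simp only [enorm_eq_self]
  have hsup : ∀ ω, (⨆ n, f n ω) ^ q = ⨆ n, f n ω ^ q := fun ω =>
    (ENNReal.orderIsoRpow q hq).map_iSup fun n => f n ω
  rw [heLp]
  simp_rw [hsup]
  rw [lintegral_iSup (fun n => (hf n).pow_const q)
    fun i j hij ω => ENNReal.rpow_le_rpow (hmono hij ω) hq.le]
  rw [one_div, ENNReal.rpow_inv_le_iff hq]
  refine iSup_le fun n => ?_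
  rw [← ENNReal.rpow_inv_le_iff hq, ← one_div, ← heLp]
  exact hK n

/-- The terms are geometric with ratio `2 ^ (1 / p - h)`, less than one because `p h > 1`. -/
theorem sum_two_pow_mul_rpow_le {p h A L : ℝ} (hp : 0 < p) (hph : 1 < p * h) (hA : 0 ≤ A)
    (hL : 0 ≤ L) (n : ℕ) :
    ∑ k ∈ Finset.range n, (2 ^ k * ENNReal.ofReal (A * (L / 2 ^ k) ^ (p * h))) ^ (1 / p)
      ≤ ENNReal.ofReal ((1 - 2 ^ (1 / p - h))⁻¹ * A ^ (1 / p) * L ^ h) := by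
  set r : ℝ := 2 ^ (1 / p - h) with hr
  have hr0 : 0 ≤ r := by positivity
  have hr1 : r < 1 := by
    refine Real.rpow_lt_one_of_one_lt_of_neg one_lt_two (sub_neg.2 ?_)
    rwa [div_lt_iff₀ hp, mul_comm]
  have hterm : ∀ k : ℕ, (2 ^ k * ENNReal.ofReal (A * (L / 2 ^ k) ^ (p * h))) ^ (1 / p) =
      ENNReal.ofReal (r ^ k * (A ^ (1 / p) * L ^ h)) := fun k => by
    have h2 : (2 : ℝ≥0∞) ^ k = ENNReal.ofReal (2 ^ k) := by
      rw [ENNReal.ofReal_pow zero_le_two, ENNReal.ofReal_ofNat]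
    rw [h2, ← ENNReal.ofReal_mul (by positivity),
      ENNReal.ofReal_rpow_of_nonneg (by positivity) (by positivity)]
    congr 1
    rw [Real.mul_rpow (by positivity) (by positivity), Real.mul_rpow hA (by positivity),
      ← Real.rpow_mul (by positivity), mul_right_comm p h, mul_one_div_cancel hp.ne', one_mul,
      Real.div_rpow hL (by positivity), hr, ← Real.rpow_natCast, ← Real.rpow_natCast,
      ← Real.rpow_mul zero_le_two, ← Real.rpow_mul zero_le_two, ← Real.rpow_mul zero_le_two,
      sub_mul, Real.rpow_sub zero_lt_two, mul_comm (k : ℝ) (1 / p), mul_comm (k : ℝ) h]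
    ring
  simp_rw [hterm]
  rw [← ENNReal.ofReal_sum_of_nonneg fun _ _ => by positivity, ← Finset.sum_mul, mul_assoc]
  refine ENNReal.ofReal_le_ofReal (mul_le_mul_of_nonneg_right ?_ (by positivity))
  rw [← tsum_geometric_of_lt_one hr0 hr1]
  exact (summable_geometric_of_lt_one hr0 hr1).sum_le_tsum _ fun _ _ => by positivity

/-! ### The uniform dyadic bound and the conclusion. -/

/-- Maximal inequality along a dyadic subdivision, with a bound independent of its level. -/
theorem eLpNorm_dyadicSup_le {Ω : Type*} {m : MeasurableSpace Ω} {P : Measure Ω}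
    [IsProbabilityMeasure P] {ℱ : Filtration ℝ≥0 m} {E : Type*} [NormedAddCommGroup E]
    [NormedSpace ℝ E] [CompleteSpace E] {X : ℝ≥0 → Ω → E} {a b : ℝ≥0} {p q h A : ℝ}
    (hph : 1 < p * h) (hq : 1 < q) (hqp : q ≤ p) (hab : a < b) (hA : 0 ≤ A)
    (hX : ∀ t ≤ b, StronglyMeasurable[ℱ t] (X t))
    (hXp : ∀ t ≤ b, MemLp (X t) (ENNReal.ofReal p) P)
    (hinc : ∀ s t : ℝ≥0, s < t → t ≤ b →
      ∫⁻ ω, ‖(P[X t | ℱ s]) ω - X s ω‖ₑ ^ p ∂P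
        ≤ ENNReal.ofReal (A * |(t : ℝ) - (s : ℝ)| ^ (p * h))) (n : ℕ) :
    eLpNorm (fun ω => dyadicSup a b (fun t => X t ω) n) (ENNReal.ofReal q) P
      ≤ ENNReal.ofReal (q / (q - 1)) *
        (ENNReal.ofReal ((1 - 2 ^ (1 / p - h))⁻¹ * A ^ (1 / p) * |(b : ℝ) - (a : ℝ)| ^ h)
          + eLpNorm (X b) (ENNReal.ofReal q) P) := by
  have hp0 : 0 < p := by linarith
  have hp1 : 1 ≤ ENNReal.ofReal p := by simpa using ENNReal.ofReal_le_ofReal (hq.le.trans hqp)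
  have hq1 : 1 ≤ ENNReal.ofReal q := by simpa using ENNReal.ofReal_le_ofReal hq.le
  have hqp' : ENNReal.ofReal q ≤ ENNReal.ofReal p := ENNReal.ofReal_le_ofReal hqp
  have hVle : ∀ k, eLpNorm (condVariation P ℱ X a b p k) (ENNReal.ofReal p) P ≤
      (2 ^ k * ENNReal.ofReal (A * (|(b : ℝ) - a| / 2 ^ k) ^ (p * h))) ^ (1 / p) := fun k => by
    refine eLpNorm_condVariation_le hp0 hab hX fun j hj => ?_
    refine (hinc _ _ (dyadicPoint.lt_succ hab hj) (dyadicPoint.le_right hab.le _ _)).trans_eq ?_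
    rw [dyadicPoint.coe_succ_sub hab.le hj, abs_div, abs_of_pos (by positivity : (0 : ℝ) < 2 ^ k)]
  have hV : ∀ k, MemLp (condVariation P ℱ X a b p k) (ENNReal.ofReal p) P := fun k =>
    ⟨(measurable_condVariation hX hab.le k).aestronglyMeasurable, (hVle k).trans_lt
      (ENNReal.rpow_lt_top_of_nonneg (by positivity) (by finiteness))⟩
  set S : Ω → ℝ := ∑ k ∈ Finset.range (n + 1), condVariation P ℱ X a b p k
  have hS : MemLp S (ENNReal.ofReal p) P := memLp_finsetSum' _ fun k _ => hV k
  have hXb : MemLp (fun ω => ‖X b ω‖) (ENNReal.ofReal q) P :=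
    ((hXp b le_rfl).mono_exponent hqp').norm
  have hmax := eLpNorm_sup'_le_of_le_condExp (μ := P)
    ⟨fun j => ℱ (dyadicPoint a b n j), fun i j hij => ℱ.mono (dyadicPoint.monotone a b n hij),
      fun j => ℱ.le _⟩ hq (x := fun j => X (dyadicPoint a b n j)) (n := 2 ^ n)
    (hXb.add (hS.mono_exponent hqp'))
    (fun j hj => norm_le_condExp_norm_add_sum_condVariation hp0 hab hX
      (fun t ht => (hXp t ht).integrable hp1) (fun k => (hV k).integrable hp1) n hj)
  refine hmax.trans (mul_le_mul' le_rfl ?_)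
  refine (eLpNorm_add_le hXb.1 hS.1 hq1).trans ?_
  rw [eLpNorm_norm, add_comm]
  gcongr
  -- On a probability space the `L^q` norm is at most the `L^p` norm, where the increments are
  -- controlled.
  calc eLpNorm S (ENNReal.ofReal q) P ≤ eLpNorm S (ENNReal.ofReal p) P :=
        eLpNorm_le_eLpNorm_of_exponent_le hqp' hS.1
    _ ≤ ∑ k ∈ Finset.range (n + 1), eLpNorm (condVariation P ℱ X a b p k) (ENNReal.ofReal p) P :=
        eLpNorm_sum_le (fun k _ => (hV k).1) hp1
    _ ≤ _ := (Finset.sum_le_sum fun k _ => hVle k).trans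
        (sum_two_pow_mul_rpow_le hp0 hph hA (abs_nonneg _) _)

theorem theorem1 (p h : ℝ) (hp : 1 < p) (hh_pos : 0 < h) (hh_le : h ≤ 1) (hph : 1 < p * h) :
    ∃ C : ℝ, 0 < C ∧
      ∀ (Ω : Type*) (m : MeasurableSpace Ω) (P : Measure Ω) (_ : IsProbabilityMeasure P)
        (ℱ : Filtration ℝ≥0 m) (_ : UsualConditions P ℱ)
        (d : ℕ) (T : ℝ≥0) (X : ℝ≥0 → Ω → EuclideanSpace ℝ (Fin d)) (A : ℝ),
        IsContinuousAdapted P ℱ T X →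
        ConditionalIncrementControl P ℱ T X p h A →
        ∀ s₀ t₀ : ℝ≥0, s₀ < t₀ → t₀ ≤ T →
        ∀ q : ℝ, 1 < q → q ≤ p →
          AEMeasurable (runningSup X s₀ t₀) P ∧
          eLpNorm (runningSup X s₀ t₀) (ENNReal.ofReal q) P
            ≤ ENNReal.ofReal (q / (q - 1)) *
              (ENNReal.ofReal (C ^ (1 / p) * A ^ (1 / p) * |(t₀ : ℝ) - (s₀ : ℝ)| ^ h)
                + eLpNorm (X t₀) (ENNReal.ofReal q) P) := by
  have hp0 : 0 < p := by linarith
  have hr1 : (2 : ℝ) ^ (1 / p - h) < 1 := by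
    refine Real.rpow_lt_one_of_one_lt_of_neg one_lt_two (sub_neg.2 ?_)
    rwa [div_lt_iff₀ hp0, mul_comm]
  have hK : 0 < (1 - (2 : ℝ) ^ (1 / p - h))⁻¹ := inv_pos.2 (sub_pos.2 hr1)
  -- Chosen so that `C ^ (1 / p)` is the sum of the geometric series.
  refine ⟨(1 - (2 : ℝ) ^ (1 / p - h))⁻¹ ^ p, Real.rpow_pos_of_pos hK p, ?_⟩
  intro Ω m P _ ℱ _ d T X A hXc hXinc s₀ t₀ hst htT q hq hqp
  rw [← Real.rpow_mul hK.le, mul_one_div_cancel hp0.ne', Real.rpow_one]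
  have hX : ∀ t ≤ t₀, StronglyMeasurable[ℱ t] (X t) := fun t ht =>
    (hXc.adapted t (ht.trans htT)).stronglyMeasurable
  have hmeas : ∀ n, Measurable fun ω => dyadicSup s₀ t₀ (fun t => X t ω) n := fun n =>
    Finset.measurable_range_sup'' fun j _ =>
      ((hX _ (dyadicPoint.le_right hst.le n j)).mono (ℱ.le _)).norm.measurable
  -- A countable supremum also gives the a.e. measurability of the uncountable one.
  have hae : runningSup X s₀ t₀ =ᵐ[P]
      fun ω => ⨆ n, ENNReal.ofReal (dyadicSup s₀ t₀ (fun t => X t ω) n) := by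
    filter_upwards [hXc.continuous] with ω hω
    exact iSup_Icc_enorm_eq_iSup_dyadicSup hst (hω.mono (Set.Icc_subset_Icc zero_le htT))
  refine ⟨(Measurable.iSup fun n => (hmeas n).ennreal_ofReal).aemeasurable.congr hae.symm, ?_⟩
  rw [eLpNorm_congr_ae hae]
  refine eLpNorm_iSup_le_of_monotone (by linarith) (fun n => (hmeas n).ennreal_ofReal)
    (fun i j hij ω => ENNReal.ofReal_le_ofReal (monotone_dyadicSup _ _ _ hij)) fun n => ?_
  refine (eLpNorm_congr_enorm_ae (.of_forall fun ω => ?_)).trans_le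
    (eLpNorm_dyadicSup_le hph hq hqp hst hXinc.nonneg hX
      (fun t ht => hXinc.memLp t (ht.trans htT))
      (fun s t hs ht => hXinc.bound s t hs (ht.trans htT)) n)
  rw [Real.enorm_of_nonneg (dyadicSup_nonneg _ _ _ n), enorm_eq_self]
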